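/- Let $X$ be a complex Banach space and $T$ a bounded linear operator on $X$, with kernel $\mathcal N(T)$ and range $\mathcal R(T)$. Let $\alpha(T)=\dim \mathcal N(T)$ and $\beta(T)=\dim X/\mathcal R(T)$, with values in $\mathbb N\cup\{\infty\}$, and for $n\in\mathbb N=\{0,1,2,\dots\}$ let $T_{[n]}$ be the restriction of $T$ to $\mathcal R(T^n)$, as an operator on $\mathcal R(T^n)$. Put $$a_e(T)=\inf\{n:\alpha(T_{[n]})<\infty\},\quad d_e(T)=\inf\{n:\beta(T_{[n]})<\infty\},\quad m_T=\inf\{n:\min\{\alpha(T_{[n]}),\beta(T_{[n]})\}<\infty\},$$ where $\inf\emptyset=\infty$. The operator $T$ is upper semi-B-Fredholm if $a_e(T)<\infty$ and $\mathcal R(T^{a_e(T)+1})$ is closed, lower semi-B-Fredholm if $d_e(T)<\infty$ and $\mathcal R(T^{d_e(T)})$ is closed, and semi-Fredholm if it is upper or lower semi-B-Fredholm and $m_T=0$ (equivalently, $\mathcal R(T)$ is closed and $\alpha(T)$ or $\beta(T)$ is finite). The degree of stable iteration of an operator is $$\mathrm{dis}(T)=\inf\{m\in\mathbb N:\ \mathcal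 N(T_{[m]})=\mathcal N(T_{[r]})\ \text{for all } r\ge m\},\qquad \mathcal N(T_{[m]})=\mathcal N(T)\cap\mathcal R(T^m),$$ and an operator is semi-regular if its range is closed and its degree of stable iteration is $0$. Write $(M,N)\in Red(T)$ if $M$ and $N$ are closed $T$-invariant subspaces with $X=M\oplus N$, and let $T_M$, $T_N$ be the restrictions of $T$ to $M$ and $N$. An operator $S$ is nilpotent of degree $d$ if $d$ is the least $n\in\mathbb N$ with $S^n=0$ (so the operator on $\{0\}$ is nilpotent of degree $0$). **Theorem.** If $T$ is semi-Fredholm, then there exists $(M,N)\in Red(T)$ such that $\dim N<\infty$, $T_M$ is semi-regular, and $T_N$ is nilpotent of degree $\mathrm{dis}(T)$ (in particular $\mathrm{dis}(T)<\infty$). -/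

import Mathlib

/-!  Bounded operators on a complex normed space: essential ascent and descent, semi-Fredholm
operators, degree of stable iteration, semi-regularity and complete reduction.
Dimensions take values in `ℕ∞`, every infinite dimension being `⊤`. -/

namespace KatoDec

noncomputable section

variable {E : Type*} [NormedAddCommGroup E] [NormedSpace ℂ E]

/-- The dimension `α(S)` of the kernel of `S`. -/
def alpha (S : E →L[ℂ] E) : ℕ∞ :=
  Cardinal.toENat (Module.rank ℂ S.ker)

/-- The codimension `β(S)` of the range of `S`. -/
def beta (S : E →L[ℂ] E) : ℕ∞ :=
  Cardinal.toENat (Module.rank ℂ (E ⧸ S.range))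

theorem apply_mem_range_pow (T : E →L[ℂ] E) (n : ℕ) :
    ∀ x ∈ (T ^ n).range, T x ∈ (T ^ n).range := by
  rintro _ ⟨y, rfl⟩
  refine ⟨T y, ?_⟩
  change (T ^ n * T) y = (T * T ^ n) y
  rw [← pow_succ, ← pow_succ']

/-- The restriction `T_[n]` of `T` to the range of `T ^ n`. -/
def restrictRange (T : E →L[ℂ] E) (n : ℕ) : (T ^ n).range →L[ℂ] (T ^ n).range :=
  T.restrict (apply_mem_range_pow T n)

/-- The essential ascent `a_e(T) = inf {n | α(T_[n]) < ∞}`, with `inf ∅ = ∞`. -/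
def essentialAscent (T : E →L[ℂ] E) : ℕ∞ :=
  ⨅ n ∈ {n : ℕ | alpha (restrictRange T n) < ⊤}, (n : ℕ∞)

/-- The essential descent `d_e(T) = inf {n | β(T_[n]) < ∞}`, with `inf ∅ = ∞`. -/
def essentialDescent (T : E →L[ℂ] E) : ℕ∞ :=
  ⨅ n ∈ {n : ℕ | beta (restrictRange T n) < ⊤}, (n : ℕ∞)

/-- The essential degree `m_T = inf {n | min (α(T_[n])) (β(T_[n])) < ∞}`, with `inf ∅ = ∞`. -/
def essentialDegree (T : E →L[ℂ] E) : ℕ∞ :=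
  ⨅ n ∈ {n : ℕ | min (alpha (restrictRange T n)) (beta (restrictRange T n)) < ⊤}, (n : ℕ∞)

/-- Upper semi-B-Fredholm: `a_e(T)` is finite and the range of `T ^ (a_e(T) + 1)` is closed. -/
def IsUpperSemiBFredholm (T : E →L[ℂ] E) : Prop :=
  ∃ a : ℕ, essentialAscent T = a ∧ IsClosed ((T ^ (a + 1)).range : Set E)

/-- Lower semi-B-Fredholm: `d_e(T)` is finite and the range of `T ^ d_e(T)` is closed. -/
def IsLowerSemiBFredholm (T : E →L[ℂ] E) : Prop :=
  ∃ d : ℕ, essentialDescent T = d ∧ IsClosed ((T ^ d).range : Set E)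

/-- Semi-B-Fredholm: upper or lower semi-B-Fredholm. -/
def IsSemiBFredholm (T : E →L[ℂ] E) : Prop :=
  IsUpperSemiBFredholm T ∨ IsLowerSemiBFredholm T

/-- Semi-Fredholm: semi-B-Fredholm with essential degree `0`. -/
def IsSemiFredholm (T : E →L[ℂ] E) : Prop :=
  IsSemiBFredholm T ∧ essentialDegree T = 0

/-- The set `Δ(T)` of the `m` from which on the kernels of the iterated restrictions `T_[r]` are
stationary. The kernel of `T_[m]`, seen inside `E`, is `ker T ⊓ range (T ^ m)`. These kernels
decrease, so where they are finite-dimensional this says that `α(T_[m]) = α(T_[r])`. -/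
def stableSet (T : E →L[ℂ] E) : Set ℕ :=
  {m | ∀ r, m ≤ r → T.ker ⊓ (T ^ m).range = T.ker ⊓ (T ^ r).range}

/-- The degree of stable iteration `dis(T) = inf Δ(T)`, with `inf ∅ = ∞`. -/
def dis (T : E →L[ℂ] E) : ℕ∞ :=
  ⨅ m ∈ stableSet T, (m : ℕ∞)

/-- Semi-regular: the range of `T` is closed and `dis(T) = 0`. -/
def IsSemiRegular (T : E →L[ℂ] E) : Prop :=
  IsClosed (T.range : Set E) ∧ dis T = 0

/-- `T` is completely reduced by `(M, N)`: `M` and `N` are closed `T`-invariant subspaces and the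
space is their direct sum. -/
structure Red (T : E →L[ℂ] E) (M N : Submodule ℂ E) : Prop where
  isClosed_left : IsClosed (M : Set E)
  isClosed_right : IsClosed (N : Set E)
  invariant_left : ∀ x ∈ M, T x ∈ M
  invariant_right : ∀ x ∈ N, T x ∈ N
  isCompl : IsCompl M N

end

end KatoDec

/-!
A Jordan chain that obstructs semi-regularity can be split off, and only finitely many of them exist.

A semi-Fredholm operator `T` has closed range and finite-dimensional kernel, or it has range of
finite codimension (`IsSemiFredholm.finiteDimensional_ker_or_cofg`). In both cases the ranges of all
powers of `T` are closed. Let `X = M ⊕ N` reduce `T`, with `N` finite-dimensional and `T_N`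
nilpotent, and suppose that the kernel of `T_M` is not contained in the range of `T ^ n`, where `n`
is least with this property. Then there is `x ∈ M` with `T ^ n x = 0` and `T ^ (n - 1) x` outside the
closed subspace `R(T ^ n)`. By Hahn-Banach there is a functional `f` with `f = 0` on `R(T ^ n)` and
`f (T ^ (n - 1) x) = 1`. The span `J` of `x, T x, …, T ^ (n - 1) x` and the closed subspace
`K = {y | f (T ^ i y) = 0 for i < n}` are invariant, and they are complementary because the matrix
`f (T ^ (i + j) x)` is triangular with respect to its antidiagonal. So `X = (M ∩ K) ⊕ (N ⊕ J)` is
again a decomposition of the same kind, with a larger kernel of `T_N` (`Red.exists_larger`).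

The dimension of the kernel of `T_N` is at most `α(T)`, and, by rank-nullity in `N`, at most `β(T)`.
For a decomposition where it is maximal, the kernel of `T_M` therefore lies in the range of every
power of `T`, so that `T_M` is semi-regular (`Red.isSemiRegular`). For such a decomposition the
degree of nilpotency of `T_N` is necessarily `dis T`, since `N(T) ∩ R(T ^ m)` is the sum of the
kernel of `T_M` and of `N(T_N) ∩ R(T_N ^ m)`, and the latter vanishes exactly when `T_N ^ m = 0`
(`Red.nilpotencyClass_eq_dis`).
-/

namespace KatoDec

open Submodule

/-! ### Powers of an operator: restrictions, kernels and ranges -/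

section Normed

variable {E : Type*} [NormedAddCommGroup E] [NormedSpace ℂ E]

theorem coe_restrict_pow_apply (T : E →L[ℂ] E) {p : Submodule ℂ E} (h : ∀ x ∈ p, T x ∈ p)
    (n : ℕ) (x : p) : (((T.restrict h) ^ n) x : E) = (T ^ n) x := by
  induction n with
  | zero => simp
  | succ n ih =>
    rw [pow_succ', pow_succ', mul_apply_eq_comp, mul_apply_eq_comp, ← ih]
    rfl

theorem pow_apply_mem (T : E →L[ℂ] E) {p : Submodule ℂ E} (h : ∀ x ∈ p, T x ∈ p)
    (n : ℕ) {x : E} (hx : x ∈ p) : (T ^ n) x ∈ p := by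
  rw [← coe_restrict_pow_apply T h n ⟨x, hx⟩]
  exact Subtype.property _

theorem pow_add_apply (T : E →L[ℂ] E) (m n : ℕ) (x : E) :
    (T ^ (m + n)) x = (T ^ m) ((T ^ n) x) := by
  rw [pow_add]; rfl

theorem pow_apply_eq_zero_of_le (T : E →L[ℂ] E) {m n : ℕ} (h : m ≤ n) {x : E}
    (hx : (T ^ m) x = 0) : (T ^ n) x = 0 := by
  obtain ⟨k, rfl⟩ := Nat.exists_eq_add_of_le' h
  rw [pow_add_apply, hx, map_zero]

theorem ker_pow_zero (T : E →L[ℂ] E) : (T ^ 0).ker = ⊥ :=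
  eq_bot_iff.2 fun _ hx ↦ hx

theorem range_pow_zero (T : E →L[ℂ] E) : (T ^ 0).range = ⊤ :=
  LinearMap.range_id

theorem range_pow_antitone (T : E →L[ℂ] E) : Antitone fun n : ℕ ↦ (T ^ n).range := by
  intro m n h
  obtain ⟨k, rfl⟩ := Nat.exists_eq_add_of_le h
  rintro _ ⟨y, rfl⟩
  exact ⟨(T ^ k) y, (pow_add_apply T m k y).symm⟩

theorem finiteDimensional_ker_pow (T : E →L[ℂ] E) [FiniteDimensional ℂ T.ker] (n : ℕ) :
    FiniteDimensional ℂ (T ^ n).ker := by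
  induction n with
  | zero => rw [ker_pow_zero]; infer_instance
  | succ n ih =>
    have : (T ^ (n + 1)).ker = comap (T : E →ₗ[ℂ] E) (T ^ n).ker := by
      ext x
      change (T ^ (n + 1)) x = 0 ↔ (T ^ n) (T x) = 0
      rw [pow_add_apply, pow_one]
    rw [this]
    infer_instance

theorem cofg_range_pow (T : E →L[ℂ] E) (h : T.range.CoFG) (n : ℕ) : (T ^ n).range.CoFG := by
  induction n with
  | zero => rw [range_pow_zero]; exact CoFG.top
  | succ n ih =>
    obtain ⟨C, hC⟩ := Submodule.exists_isCompl T.range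
    obtain ⟨D, hD⟩ := Submodule.exists_isCompl (T ^ n).range
    have hCf := h.fg_of_isCompl hC
    have hDf := ih.fg_of_isCompl hD
    refine FG.cofg_of_codisjoint (S := map ((T ^ n : E →L[ℂ] E) : E →ₗ[ℂ] E) C ⊔ D) ?_
      ((hCf.map _).sup hDf)
    rw [codisjoint_iff, sup_comm, ← sup_assoc, ← hD.sup_eq_top]
    congr 1
    refine le_antisymm (sup_le (range_pow_antitone T n.le_succ) ?_) ?_
    · rintro _ ⟨y, -, rfl⟩
      exact ⟨y, rfl⟩
    · rintro _ ⟨y, rfl⟩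
      obtain ⟨_, ⟨z, rfl⟩, c, hc, rfl⟩ := mem_sup.1 (hC.sup_eq_top ▸ mem_top : y ∈ T.range ⊔ C)
      refine mem_sup.2 ⟨(T ^ (n + 1)) z, ⟨z, rfl⟩, (T ^ n) c, ⟨c, hc, rfl⟩, ?_⟩
      rw [pow_add_apply T n 1, pow_one]
      exact (map_add _ _ _).symm

/-! ### What the semi-Fredholm condition says about the kernel and the range -/

/-- A finite infimum is attained. -/
theorem of_iInf_natCast_eq {P : ℕ → Prop} {a : ℕ} (h : ⨅ n ∈ {n | P n}, (n : ℕ∞) = a) : P a := by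
  by_contra hP
  have : ((a + 1 : ℕ) : ℕ∞) ≤ ⨅ n ∈ {n | P n}, (n : ℕ∞) := by
    refine le_iInf₂ fun n hn ↦ ?_
    have h1 : ((a : ℕ) : ℕ∞) ≤ n := h ▸ iInf₂_le n hn
    have h2 : a ≠ n := by rintro rfl; exact hP hn
    exact_mod_cast lt_of_le_of_ne (by exact_mod_cast h1) h2
  rw [h] at this
  norm_cast at this
  omega

theorem finiteDimensional_ker_of_alpha (T : E →L[ℂ] E) (h : alpha (restrictRange T 0) < ⊤) :
    FiniteDimensional ℂ T.ker := by
  rw [alpha, Cardinal.toENat_lt_top, Module.rank_lt_aleph0_iff] at h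
  let g : T.ker →ₗ[ℂ] (restrictRange T 0).ker :=
    { toFun := fun x ↦ ⟨⟨x, x, rfl⟩, Subtype.ext x.2⟩
      map_add' := fun _ _ ↦ rfl
      map_smul' := fun _ _ ↦ rfl }
  refine Module.Finite.of_injective g fun x y hxy ↦ Subtype.ext ?_
  exact congrArg (fun z : (restrictRange T 0).ker ↦ ((z : (T ^ 0).range) : E)) hxy

/-- If `R (T ^ (d + 1))` has finite codimension in `R (T ^ d)`, then `R (T) + N (T ^ d)` has finite
codimension, being the kernel of the map to the quotient that `T ^ d` induces. -/
theorem cofg_range_of_beta (T : E →L[ℂ] E) (d : ℕ) [FiniteDimensional ℂ (T ^ d).ker]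
    (h : beta (restrictRange T d) < ⊤) : T.range.CoFG := by
  rw [beta, Cardinal.toENat_lt_top, Module.rank_lt_aleph0_iff] at h
  let g := (restrictRange T d).range.mkQ ∘ₗ ((T ^ d : E →L[ℂ] E) : E →ₗ[ℂ] E).rangeRestrict
  have hg : g.ker ≤ T.range ⊔ (T ^ d).ker := by
    intro y hy
    have hy' : (((T ^ d : E →L[ℂ] E) : E →ₗ[ℂ] E).rangeRestrict y) ∈ (restrictRange T d).range := by
      rw [← Submodule.Quotient.mk_eq_zero]
      exact hy
    obtain ⟨⟨_, z, rfl⟩, hz⟩ := hy'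
    have hz' : T ((T ^ d) z) = (T ^ d) y := congrArg Subtype.val hz
    refine mem_sup.2 ⟨T z, ⟨z, rfl⟩, y - T z, ?_, by abel⟩
    have : (T ^ d) (T z) = T ((T ^ d) z) := by
      have h1 := pow_add_apply T d 1 z
      rw [add_comm, pow_add_apply, pow_one] at h1
      exact h1.symm
    change (T ^ d) (y - T z) = 0
    rw [map_sub, this, hz', sub_self]
  have h1 : (T.range ⊔ (T ^ d).ker).CoFG := (CoFG.ker g).of_le hg
  obtain ⟨C, hC⟩ := Submodule.exists_isCompl (T.range ⊔ (T ^ d).ker)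
  have hCf := h1.fg_of_isCompl hC
  refine FG.cofg_of_codisjoint (S := (T ^ d).ker ⊔ C) ?_ (.sup (.of_finite) hCf)
  rw [codisjoint_iff, sup_comm, ← sup_assoc, hC.sup_eq_top]

/-- The mixed case is `α(T) < ∞` with `T` lower semi-B-Fredholm: then `N(T ^ d_e(T))` is
finite-dimensional, and so `β(T) < ∞`. -/
theorem IsSemiFredholm.finiteDimensional_ker_or_cofg {T : E →L[ℂ] E} (hT : IsSemiFredholm T) :
    (FiniteDimensional ℂ T.ker ∧ IsClosed (T.range : Set E)) ∨ T.range.CoFG := by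
  obtain ⟨hB, hm⟩ := hT
  have hm := of_iInf_natCast_eq
    (P := fun n ↦ min (alpha (restrictRange T n)) (beta (restrictRange T n)) < ⊤) (a := 0) hm
  rcases min_lt_iff.1 hm with hα | hβ
  · have := finiteDimensional_ker_of_alpha T hα
    rcases hB with ⟨a, ha, hcl⟩ | ⟨d, hd, -⟩
    · have h0 : essentialAscent T ≤ (0 : ℕ) := iInf₂_le 0 hα
      rw [ha] at h0
      obtain rfl : a = 0 := by simpa using h0
      rw [zero_add, pow_one] at hcl
      exact .inl ⟨this, hcl⟩
    · have := finiteDimensional_ker_pow T d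
      exact .inr (cofg_range_of_beta T d
        (of_iInf_natCast_eq (P := fun n ↦ beta (restrictRange T n) < ⊤) hd))
  · have : FiniteDimensional ℂ (T ^ 0).ker := by
      rw [ker_pow_zero]; infer_instance
    exact .inr (cofg_range_of_beta T 0 hβ)

end Normed

/-! ### Closed ranges -/

section Banach

variable {X : Type*} [NormedAddCommGroup X] [NormedSpace ℂ X] [CompleteSpace X]

/-- The operator `(x, c) ↦ T x + c` from `X × C` onto `X` is a quotient map, and the preimage of the
range of `T` is `X × {0}`. -/
theorem isClosed_range_of_cofg (T : X →L[ℂ] X) (h : T.range.CoFG) : IsClosed (T.range : Set X) := by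
  obtain ⟨C, hC⟩ := Submodule.exists_isCompl T.range
  have : FiniteDimensional ℂ C := .of_fg (h.fg_of_isCompl hC)
  let S : (X × C) →L[ℂ] X := T.coprod C.subtypeL
  have hS : Function.Surjective S := by
    intro y
    obtain ⟨_, ⟨z, rfl⟩, c, hc, rfl⟩ := mem_sup.1 (hC.sup_eq_top ▸ mem_top : y ∈ T.range ⊔ C)
    exact ⟨(z, ⟨c, hc⟩), rfl⟩
  rw [← (S.isQuotientMap hS).isClosed_preimage]
  have : S ⁻¹' (T.range : Set X) = Prod.snd ⁻¹' {0} := by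
    ext ⟨x, c⟩
    have : S (x, c) = T x + c := rfl
    simp only [Set.mem_preimage, this, SetLike.mem_coe, Set.mem_singleton_iff]
    have hx : T x ∈ T.range := ⟨x, rfl⟩
    rw [Submodule.add_mem_iff_right T.range hx]
    refine ⟨fun hc ↦ Subtype.ext (disjoint_def.1 hC.disjoint _ hc c.2), ?_⟩
    rintro rfl
    exact zero_mem _
  rw [this]
  exact isClosed_singleton.preimage continuous_snd

/-- An operator with closed range and finite-dimensional kernel maps closed subspaces to closed
subspaces: modulo the open mapping onto the range this is closedness of `F ⊔ ker T`. -/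
theorem isClosed_map_of_finiteDimensional_ker (T : X →L[ℂ] X) [FiniteDimensional ℂ T.ker]
    (h : IsClosed (T.range : Set X)) (F : Submodule ℂ X) (hF : IsClosed (F : Set X)) :
    IsClosed (F.map (T : X →ₗ[ℂ] X) : Set X) := by
  have : CompleteSpace T.range := h.completeSpace_coe
  have hq := T.rangeRestrict.isQuotientMap (LinearMap.surjective_rangeRestrict (T : X →ₗ[ℂ] X))
  have h1 : IsClosed ((↑) ⁻¹' (F.map (T : X →ₗ[ℂ] X) : Set X) : Set T.range) := by
    rw [← hq.isClosed_preimage]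
    have : T.rangeRestrict ⁻¹' ((↑) ⁻¹' (F.map (T : X →ₗ[ℂ] X) : Set X))
        = (F ⊔ T.ker : Submodule ℂ X) := by
      rw [← comap_map_eq]; rfl
    rw [this]
    exact isClosed_sup_finiteDimensional _ _ hF
  have h2 := h.isClosedMap_subtype_val _ h1
  have h3 : (F.map (T : X →ₗ[ℂ] X) : Set X) ⊆ Set.range ((↑) : T.range → X) := by
    rintro _ ⟨y, -, rfl⟩
    exact ⟨⟨T y, y, rfl⟩, rfl⟩
  exact Set.image_preimage_eq_of_subset h3 ▸ h2

theorem isClosed_range_pow_of_finiteDimensional_ker (T : X →L[ℂ] X) [FiniteDimensional ℂ T.ker]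
    (h : IsClosed (T.range : Set X)) (n : ℕ) : IsClosed ((T ^ n).range : Set X) := by
  induction n with
  | zero => rw [range_pow_zero]; exact isClosed_univ
  | succ n ih =>
    have : (T ^ (n + 1)).range = map (T : X →ₗ[ℂ] X) (T ^ n).range := by
      rw [pow_succ']
      exact LinearMap.range_comp _ _
    rw [this]
    exact isClosed_map_of_finiteDimensional_ker T h _ ih

end Banach

/-! ### Splitting off a Jordan chain -/

section JordanChain

variable {E : Type*} [NormedAddCommGroup E] [NormedSpace ℂ E]

/-- The map `a ↦ ∑ i, a i • T ^ i x`, whose range is spanned by the chain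
`x, T x, …, T ^ (n - 1) x`. -/
noncomputable def chainMap (T : E →L[ℂ] E) (x : E) (n : ℕ) : (Fin n → ℂ) →ₗ[ℂ] E :=
  Fintype.linearCombination ℂ fun i : Fin n ↦ (T ^ (i : ℕ)) x

/-- The map `y ↦ (f (T ^ i y))_{i < n}`. -/
noncomputable def cochainMap (T : E →L[ℂ] E) (f : E →L[ℂ] ℂ) (n : ℕ) : E →L[ℂ] (Fin n → ℂ) :=
  .pi fun i ↦ f ∘L T ^ (i : ℕ)

theorem chainMap_apply (T : E →L[ℂ] E) (x : E) (n : ℕ) (a : Fin n → ℂ) :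
    chainMap T x n a = ∑ i : Fin n, a i • (T ^ (i : ℕ)) x :=
  Fintype.linearCombination_apply ..

theorem cochainMap_apply (T : E →L[ℂ] E) (f : E →L[ℂ] ℂ) (n : ℕ) (y : E) (i : Fin n) :
    cochainMap T f n y i = f ((T ^ (i : ℕ)) y) :=
  rfl

theorem pow_chain_mem_range_chainMap (T : E →L[ℂ] E) {x : E} {n : ℕ} (hx : (T ^ n) x = 0) (k : ℕ) :
    (T ^ k) x ∈ (chainMap T x n).range := by
  by_cases hk : k < n
  · exact ⟨Pi.single ⟨k, hk⟩ 1, by simp [chainMap]⟩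
  · rw [pow_apply_eq_zero_of_le T (not_lt.1 hk) hx]
    exact zero_mem _

theorem apply_mem_range_chainMap (T : E →L[ℂ] E) {x : E} {n : ℕ} (hx : (T ^ n) x = 0) :
    ∀ y ∈ (chainMap T x n).range, T y ∈ (chainMap T x n).range := by
  rintro _ ⟨a, rfl⟩
  rw [chainMap_apply, map_sum]
  refine sum_mem fun i _ ↦ ?_
  rw [map_smul]
  refine smul_mem _ _ ?_
  have := pow_chain_mem_range_chainMap T hx (1 + i)
  rwa [pow_add_apply, pow_one] at this

theorem range_chainMap_le_ker_pow (T : E →L[ℂ] E) {x : E} {n : ℕ} (hx : (T ^ n) x = 0) :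
    (chainMap T x n).range ≤ (T ^ n).ker := by
  rintro _ ⟨a, rfl⟩
  change (T ^ n) (chainMap T x n a) = 0
  rw [chainMap_apply, map_sum]
  refine Finset.sum_eq_zero fun i _ ↦ ?_
  rw [map_smul, ← pow_add_apply, pow_apply_eq_zero_of_le T (Nat.le_add_right _ _) hx, smul_zero]

theorem apply_mem_ker_cochainMap (T : E →L[ℂ] E) {f : E →L[ℂ] ℂ} {n : ℕ}
    (hf : ∀ y, f ((T ^ n) y) = 0) : ∀ y ∈ (cochainMap T f n).ker, T y ∈ (cochainMap T f n).ker := by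
  intro y hy
  have hy' : cochainMap T f n y = 0 := hy
  change cochainMap T f n (T y) = 0
  ext i
  have h1 : f ((T ^ (i : ℕ)) (T y)) = f ((T ^ ((i : ℕ) + 1)) y) := by
    rw [pow_add_apply, pow_one]
  rw [cochainMap_apply, h1]
  rcases (Nat.succ_le_of_lt i.2).lt_or_eq with h | h
  · exact congrFun hy' ⟨i + 1, h⟩
  · rw [← Nat.succ_eq_add_one, h, hf]
    rfl

/-- The matrix `(f (T ^ (i + j) x))` with `i, j < n` is zero where `i + j > n - 1` and one where
`i + j = n - 1`. -/
theorem injective_cochainMap_chainMap (T : E →L[ℂ] E) {f : E →L[ℂ] ℂ} {x : E} {n : ℕ}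
    (hx : (T ^ n) x = 0) (hf : f ((T ^ (n - 1)) x) = 1) (a : Fin n → ℂ)
    (ha : cochainMap T f n (chainMap T x n a) = 0) : a = 0 := by
  have key : ∀ (l : ℕ) (hl : l < n), a ⟨l, hl⟩ = 0 := by
    intro l
    induction l using Nat.strong_induction_on with
    | _ l ih =>
      intro hl
      have h1 := congrFun ha ⟨n - 1 - l, by omega⟩
      rw [cochainMap_apply, chainMap_apply, map_sum, map_sum,
        Finset.sum_eq_single ⟨l, hl⟩ ?_ (by simp)] at h1
      · rw [map_smul, map_smul, ← pow_add_apply] at h1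
        rwa [show n - 1 - l + l = n - 1 by omega, hf, smul_eq_mul, mul_one] at h1
      · intro m _ hm
        have hm' : (m : ℕ) ≠ l := fun h ↦ hm (Fin.ext h)
        rcases lt_or_gt_of_ne hm' with h | h
        · rw [ih m h m.2, zero_smul, map_zero, map_zero]
        · rw [map_smul, ← pow_add_apply, pow_apply_eq_zero_of_le T (m := n) (by simp; omega) hx,
            smul_zero, map_zero]
  exact funext fun i ↦ key i i.2

theorem isCompl_ker_cochainMap_range_chainMap (T : E →L[ℂ] E) {f : E →L[ℂ] ℂ} {x : E} {n : ℕ}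
    (hx : (T ^ n) x = 0) (hf : f ((T ^ (n - 1)) x) = 1) :
    IsCompl (cochainMap T f n).ker (chainMap T x n).range := by
  have hinj := injective_cochainMap_chainMap T hx hf
  constructor
  · rw [disjoint_def]
    rintro _ hy ⟨a, rfl⟩
    rw [hinj a hy, map_zero]
  · rw [codisjoint_iff, eq_top_iff]
    intro y _
    let g : (Fin n → ℂ) →ₗ[ℂ] (Fin n → ℂ) := (cochainMap T f n : E →ₗ[ℂ] _) ∘ₗ chainMap T x n
    have hg : Function.Injective g := (injective_iff_map_eq_zero g).2 hinj
    obtain ⟨a, ha⟩ := LinearMap.injective_iff_surjective.1 hg (cochainMap T f n y)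
    refine mem_sup.2 ⟨y - chainMap T x n a, ?_, chainMap T x n a, ⟨a, rfl⟩, by abel⟩
    change cochainMap T f n (y - chainMap T x n a) = 0
    rw [map_sub, sub_eq_zero]
    exact ha.symm

theorem exists_dual_eq_one_of_notMem (V : Submodule ℂ E) (hV : IsClosed (V : Set E)) {u : E}
    (hu : u ∉ V) : ∃ f : E →L[ℂ] ℂ, (∀ v ∈ V, f v = 0) ∧ f u = 1 := by
  have := hV
  have hu' : V.mkQ u ≠ 0 := fun h ↦ hu ((Submodule.Quotient.mk_eq_zero V).1 h)
  obtain ⟨f, hf⟩ := SeparatingDual.exists_eq_one (R := ℂ) hu'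
  refine ⟨f ∘L V.mkQL, fun v hv ↦ ?_, hf⟩
  have : V.mkQ v = 0 := (Submodule.Quotient.mk_eq_zero V).2 hv
  change f (V.mkQ v) = 0
  rw [this, map_zero]

end JordanChain

section Red

variable {E : Type*} [NormedAddCommGroup E] [NormedSpace ℂ E] {T : E →L[ℂ] E}
  {M N : Submodule ℂ E}

theorem Red.exists_add (h : Red T M N) (y : E) : ∃ m ∈ M, ∃ n ∈ N, m + n = y :=
  mem_sup.1 (h.isCompl.sup_eq_top ▸ mem_top)

/-- For `u ∈ M` being in the range of `T ^ n` means the same in `E` as in `M`: the `N`-component of a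
preimage is mapped to `M ∩ N = 0` and may be dropped. -/
theorem Red.exists_pow_eq_left (h : Red T M N) {n : ℕ} {u : E} (hu : u ∈ M)
    (hr : u ∈ (T ^ n).range) : ∃ x ∈ M, (T ^ n) x = u := by
  obtain ⟨y, hy⟩ := hr
  obtain ⟨a, ha, b, hb, rfl⟩ := h.exists_add y
  refine ⟨a, ha, ?_⟩
  have hy' : (T ^ n) a + (T ^ n) b = u := by rw [← map_add]; exact hy
  have h1 : (T ^ n) b = u - (T ^ n) a := by rw [← hy']; abel
  have h2 : (T ^ n) b = 0 := disjoint_def.1 h.isCompl.disjoint _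
    (h1 ▸ sub_mem hu (pow_apply_mem T h.invariant_left n ha))
    (pow_apply_mem T h.invariant_right n hb)
  rw [← hy', h2, add_zero]

theorem Red.symm (h : Red T M N) : Red T N M :=
  ⟨h.isClosed_right, h.isClosed_left, h.invariant_right, h.invariant_left, h.isCompl.symm⟩

/-- If the kernel of `T_M` is not contained in the range of `T ^ n`, a Jordan chain in `M` can be
moved from `M` to `N`. The functional `f` that defines the new left part vanishes on the range of
`T ^ n` for the least such `n`, and is `1` at the end `T ^ (n - 1) x` of the chain. -/
theorem Red.exists_larger (h : Red T M N) [FiniteDimensional ℂ N]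
    (hcl : ∀ n : ℕ, IsClosed ((T ^ n).range : Set E)) {k : ℕ} (hk : N ≤ (T ^ k).ker)
    {n : ℕ} (hn : ¬ T.ker ⊓ M ≤ (T ^ n).range) :
    ∃ M' N' : Submodule ℂ E, Red T M' N' ∧ FiniteDimensional ℂ N' ∧ (∃ k, N' ≤ (T ^ k).ker) ∧
      T.ker ⊓ N < T.ker ⊓ N' := by
  classical
  have hex : ∃ n, ¬ T.ker ⊓ M ≤ (T ^ n).range := ⟨n, hn⟩
  obtain ⟨n, hn, hmin⟩ : ∃ n, ¬ T.ker ⊓ M ≤ (T ^ n).range ∧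
      ∀ m < n, T.ker ⊓ M ≤ (T ^ m).range :=
    ⟨Nat.find hex, Nat.find_spec hex, fun m hm ↦ not_not.1 (Nat.find_min hex hm)⟩
  have hn0 : n ≠ 0 := by
    rintro rfl
    exact hn (range_pow_zero T ▸ le_top)
  obtain ⟨u, ⟨hu, huM⟩, hur⟩ := SetLike.not_le_iff_exists.1 hn
  obtain ⟨x, hxM, hxu⟩ := h.exists_pow_eq_left huM (hmin (n - 1) (by omega) ⟨hu, huM⟩)
  have hx : (T ^ n) x = 0 := by
    have h1 : n = 1 + (n - 1) := by omega
    rw [h1, pow_add_apply, hxu, pow_one]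
    exact hu
  obtain ⟨f, hf0, hf1⟩ := exists_dual_eq_one_of_notMem _ (hcl n) hur
  set K := (cochainMap T f n).ker with hK
  set J := (chainMap T x n).range with hJ
  have hKJ : IsCompl K J := isCompl_ker_cochainMap_range_chainMap T hx (hxu ▸ hf1)
  have hJM : J ≤ M := by
    rintro _ ⟨a, rfl⟩
    rw [chainMap_apply]
    exact sum_mem fun i _ ↦ smul_mem _ _ (pow_apply_mem T h.invariant_left _ hxM)
  have hJi : ∀ y ∈ J, T y ∈ J := apply_mem_range_chainMap T hx
  have : FiniteDimensional ℂ J := inferInstance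
  have huJ : u ∈ J := hxu ▸ pow_chain_mem_range_chainMap T hx (n - 1)
  refine ⟨M ⊓ K, N ⊔ J, ⟨?_, closed_of_finiteDimensional _, ?_, ?_, ?_⟩, inferInstance, ⟨k + n, ?_⟩,
    lt_of_le_of_ne (inf_le_inf_left _ le_sup_left) ?_⟩
  · exact h.isClosed_left.inter (cochainMap T f n).isClosed_ker
  · exact fun y hy ↦ ⟨h.invariant_left y hy.1,
      apply_mem_ker_cochainMap T (fun z ↦ hf0 _ ⟨z, rfl⟩) y hy.2⟩
  · intro y hy
    obtain ⟨a, ha, b, hb, rfl⟩ := mem_sup.1 hy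
    rw [map_add]
    exact add_mem (mem_sup_left (h.invariant_right a ha)) (mem_sup_right (hJi b hb))
  · constructor
    · rw [disjoint_def]
      rintro y ⟨hyM, hyK⟩ hy
      obtain ⟨a, ha, b, hb, rfl⟩ := mem_sup.1 hy
      have ha0 : a = 0 := disjoint_def.1 h.isCompl.disjoint a
        ((Submodule.add_mem_iff_left M (hJM hb)).1 hyM) ha
      rw [ha0, zero_add] at hyK ⊢
      exact disjoint_def.1 hKJ.disjoint b hyK hb
    · rw [codisjoint_iff, sup_comm N J, ← sup_assoc, inf_sup_assoc_of_le K hJM, hKJ.sup_eq_top,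
        inf_top_eq, h.isCompl.sup_eq_top]
  · refine sup_le (fun y hy ↦ ?_) fun y hy ↦ ?_
    · exact pow_apply_eq_zero_of_le T (Nat.le_add_right k n) (hk hy)
    · exact pow_apply_eq_zero_of_le T (Nat.le_add_left n k) (range_chainMap_le_ker_pow T hx hy)
  · intro heq
    have huN : u ∈ T.ker ⊓ N := heq ▸ ⟨hu, mem_sup_right huJ⟩
    have hu0 : u = 0 := disjoint_def.1 h.isCompl.disjoint u huM huN.2
    exact hur (hu0 ▸ zero_mem _)

/-! ### The number of Jordan chains is bounded -/

/-- By rank–nullity in `N`, the kernel of `T_N` has the dimension of `N / T N`, and `T N` is the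
part of the range of `T` in `N`. -/
theorem Red.finrank_ker_inf_le_of_cofg (h : Red T M N) [FiniteDimensional ℂ N]
    (hT : T.range.CoFG) :
    Module.finrank ℂ (T.ker ⊓ N : Submodule ℂ E) ≤ Module.finrank ℂ (E ⧸ T.range) := by
  have : FiniteDimensional ℂ (E ⧸ T.range) := hT
  let g := (T : E →ₗ[ℂ] E).domRestrict N
  let q := T.range.mkQ.domRestrict N
  have h1 := g.finrank_range_add_finrank_ker
  have h2 := q.finrank_range_add_finrank_ker
  have h3 : map N.subtype q.ker = g.range := by
    ext y
    constructor
    · rintro ⟨z, hz, rfl⟩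
      have hz' : (z : E) ∈ (T ^ 1).range := by
        rw [pow_one]
        exact (Submodule.Quotient.mk_eq_zero _).1 hz
      obtain ⟨w, hw, hwz⟩ := h.symm.exists_pow_eq_left z.2 hz'
      rw [pow_one] at hwz
      exact ⟨⟨w, hw⟩, hwz⟩
    · rintro ⟨z, rfl⟩
      exact ⟨⟨T z, h.invariant_right z z.2⟩, (Submodule.Quotient.mk_eq_zero _).2 ⟨z, rfl⟩, rfl⟩
  have h4 : map N.subtype g.ker = T.ker ⊓ N := by
    ext y
    constructor
    · rintro ⟨z, hz, rfl⟩
      exact ⟨hz, z.2⟩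
    · rintro ⟨hy, hyN⟩
      exact ⟨⟨y, hyN⟩, hy, rfl⟩
  have h5 := finrank_map_subtype_eq N q.ker
  have h6 := finrank_map_subtype_eq N g.ker
  rw [h3] at h5
  rw [h4] at h6
  have h7 := q.range.finrank_le
  omega

/-- The decomposition for which the kernel of `T_N` has the largest dimension leaves nothing to split
off. -/
theorem exists_red_ker_inf_le_range_pow (T : E →L[ℂ] E)
    (hcl : ∀ n : ℕ, IsClosed ((T ^ n).range : Set E))
    (hT : FiniteDimensional ℂ T.ker ∨ T.range.CoFG) :
    ∃ M N : Submodule ℂ E, Red T M N ∧ FiniteDimensional ℂ N ∧ (∃ k, N ≤ (T ^ k).ker) ∧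
      ∀ n, T.ker ⊓ M ≤ (T ^ n).range := by
  let P : ℕ → Prop := fun d ↦ ∃ M N : Submodule ℂ E, Red T M N ∧ FiniteDimensional ℂ N ∧
    (∃ k, N ≤ (T ^ k).ker) ∧ Module.finrank ℂ (T.ker ⊓ N : Submodule ℂ E) = d
  have hbound : ∃ B, ∀ d, P d → d ≤ B := by
    rcases hT with hT | hT
    · refine ⟨Module.finrank ℂ T.ker, ?_⟩
      rintro _ ⟨M, N, -, -, -, rfl⟩
      exact finrank_mono inf_le_left
    · refine ⟨Module.finrank ℂ (E ⧸ T.range), ?_⟩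
      rintro _ ⟨M, N, h, hN, -, rfl⟩
      exact h.finrank_ker_inf_le_of_cofg hT
  obtain ⟨B, hB⟩ := hbound
  have hP0 : ∃ d, P d := by
    refine ⟨_, ⊤, ⊥, ⟨isClosed_univ, ?_, fun _ _ ↦ mem_top, ?_, isCompl_top_bot⟩, inferInstance,
      ⟨0, bot_le⟩, rfl⟩
    · exact isClosed_singleton
    · intro x hx
      rw [mem_bot] at hx ⊢
      rw [hx, map_zero]
  -- The greatest dimension of `N(T) ∩ N` is attained; `Red.exists_larger` would exceed it.
  classical
  obtain ⟨d0, hd0⟩ := hP0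
  obtain ⟨M, N, h, hN, ⟨k, hk⟩, hd⟩ := Nat.findGreatest_spec (hB _ hd0) hd0
  refine ⟨M, N, h, hN, ⟨k, hk⟩, ?_⟩
  by_contra! hn
  obtain ⟨n, hn⟩ := hn
  obtain ⟨M', N', h', hN', hk', hlt⟩ := h.exists_larger hcl hk hn
  have hP' : P (Module.finrank ℂ (T.ker ⊓ N' : Submodule ℂ E)) := ⟨M', N', h', hN', hk', rfl⟩
  have h1 := Nat.le_findGreatest (hB _ hP') hP'
  have : FiniteDimensional ℂ (T.ker ⊓ N' : Submodule ℂ E) := inferInstance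
  have h2 := finrank_lt_finrank_of_lt hlt
  omega

/-! ### Semi-regularity and the degree of nilpotency -/

theorem Red.isSemiRegular (h : Red T M N) (hcl : IsClosed (T.range : Set E))
    (hM : ∀ n, T.ker ⊓ M ≤ (T ^ n).range) : IsSemiRegular (T.restrict h.invariant_left) := by
  constructor
  · have : ((T.restrict h.invariant_left).range : Set M) = (↑) ⁻¹' (T.range : Set E) := by
      ext y
      constructor
      · rintro ⟨z, rfl⟩
        exact ⟨z, rfl⟩
      · intro hy
        have hy' : (y : E) ∈ (T ^ 1).range := by rw [pow_one]; exact hy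
        obtain ⟨x, hx, hxy⟩ := h.exists_pow_eq_left y.2 hy'
        rw [pow_one] at hxy
        exact ⟨⟨x, hx⟩, Subtype.ext hxy⟩
    rw [this]
    exact hcl.preimage continuous_subtype_val
  · refine nonpos_iff_eq_zero.1 (iInf₂_le_of_le 0 (fun r _ ↦ ?_) le_rfl)
    rw [range_pow_zero, inf_top_eq, eq_comm, inf_eq_left]
    intro y hy
    obtain ⟨x, hx, hxy⟩ := h.exists_pow_eq_left y.2 (hM r ⟨congrArg Subtype.val hy, y.2⟩)
    exact ⟨⟨x, hx⟩, Subtype.ext ((coe_restrict_pow_apply T h.invariant_left r ⟨x, hx⟩).trans hxy)⟩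

/-- The part of `ker T` in `M` lies in the range of every power, and the part in `N` of the kernels
`N(T) ∩ R(T ^ m)` becomes zero exactly from the degree of nilpotency of `T_N` on. -/
theorem Red.nilpotencyClass_eq_dis (h : Red T M N) (hM : ∀ n, T.ker ⊓ M ≤ (T ^ n).range)
    (hnil : IsNilpotent (T.restrict h.invariant_right)) :
    (nilpotencyClass (T.restrict h.invariant_right) : ℕ∞) = dis T := by
  set S := T.restrict h.invariant_right with hS
  have hSk : ∀ y ∈ N, (T ^ nilpotencyClass S) y = 0 := by
    intro y hy
    rw [← coe_restrict_pow_apply T h.invariant_right _ ⟨y, hy⟩, ← hS, pow_nilpotencyClass hnil]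
    rfl
  have hkM : ∀ y, ∃ a ∈ M, (T ^ nilpotencyClass S) y = (T ^ nilpotencyClass S) a := by
    intro y
    obtain ⟨a, ha, b, hb, rfl⟩ := h.exists_add y
    exact ⟨a, ha, by rw [map_add, hSk b hb, add_zero]⟩
  refine le_antisymm (le_iInf₂ fun m hm ↦ ?_) (iInf₂_le _ ?_)
  · by_contra! hlt
    have hlt : m < nilpotencyClass S := by exact_mod_cast hlt
    obtain ⟨j, hj⟩ : ∃ j, nilpotencyClass S = j + 1 := Nat.exists_eq_succ_of_ne_zero (by omega)
    have hj0 : S ^ j ≠ 0 := (nilpotencyClass_eq_succ_iff.1 hj).2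
    -- For `w ∈ N`, `T ^ j w` lies in `N(T) ∩ R(T ^ m)`, hence in the range of `T ^ (j + 1)`, which
    -- is contained in `M`.
    refine hj0 (ContinuousLinearMap.ext fun w ↦ Subtype.ext ?_)
    rw [coe_restrict_pow_apply]
    have hv : (T ^ j) (w : E) ∈ T.ker ⊓ (T ^ m).range := by
      refine ⟨?_, range_pow_antitone T (show m ≤ j by omega) ⟨w, rfl⟩⟩
      have := hSk w w.2
      rwa [hj, add_comm, pow_add_apply, pow_one] at this
    rw [hm _ hlt.le] at hv
    obtain ⟨y, hy⟩ := hv.2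
    obtain ⟨a, ha, hya⟩ := hkM y
    refine disjoint_def.1 h.isCompl.disjoint _ ?_ (pow_apply_mem T h.invariant_right j w.2)
    rw [← hy]
    exact hya ▸ pow_apply_mem T h.invariant_left _ ha
  · intro r hr
    refine le_antisymm (fun u hu ↦ ⟨hu.1, ?_⟩) (inf_le_inf_left _ (range_pow_antitone T hr))
    obtain ⟨y, hy⟩ := hu.2
    obtain ⟨a, ha, hya⟩ := hkM y
    refine hM r ⟨hu.1, ?_⟩
    rw [← hy]
    exact hya ▸ pow_apply_mem T h.invariant_left _ ha

end Red

end KatoDec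

theorem mainTheorem2 {X : Type*} [NormedAddCommGroup X] [NormedSpace ℂ X] [CompleteSpace X]
    (T : X →L[ℂ] X) (hT : KatoDec.IsSemiFredholm T) :
    ∃ (M N : Submodule ℂ X) (h : KatoDec.Red T M N),
      FiniteDimensional ℂ N ∧
      KatoDec.IsSemiRegular (T.restrict h.invariant_left) ∧
      IsNilpotent (T.restrict h.invariant_right) ∧
      (nilpotencyClass (T.restrict h.invariant_right) : ℕ∞) = KatoDec.dis T := by
  have hT' := hT.finiteDimensional_ker_or_cofg
  have hcl : ∀ n : ℕ, IsClosed ((T ^ n).range : Set X) := by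
    intro n
    rcases hT' with ⟨hker, hran⟩ | hran
    · exact KatoDec.isClosed_range_pow_of_finiteDimensional_ker T hran n
    · exact KatoDec.isClosed_range_of_cofg _ (KatoDec.cofg_range_pow T hran n)
  obtain ⟨M, N, h, hN, ⟨k, hk⟩, hM⟩ :=
    KatoDec.exists_red_ker_inf_le_range_pow T hcl (hT'.imp_left And.left)
  have hnil : IsNilpotent (T.restrict h.invariant_right) := by
    refine ⟨k, ContinuousLinearMap.ext fun w ↦ Subtype.ext ?_⟩
    rw [KatoDec.coe_restrict_pow_apply]
    exact hk w.2
  exact ⟨M, N, h, hN, h.isSemiRegular (pow_one T ▸ hcl 1) hM, hnil,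
    h.nilpotencyClass_eq_dis hM hnil⟩
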